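/- Conventions. Cardinals are initial ordinals, so a cardinal is also the set of ordinals below it, and regular cardinals are infinite. For cardinals $\kappa,\lambda$ let $\mathrm{PP}_\kappa(\lambda)$ be the collection of all cofinalities $\operatorname{cof}\bigl(\prod_{\mu\in\mathfrak a}\mu/\mathcal F\bigr)$, where $\mathfrak a$ is a set of at most $\kappa$ regular cardinals, all smaller than $\lambda$, and $\mathcal F$ is an ultrafilter on $\mathfrak a$ which contains no subset of $\mathfrak a$ that is bounded below $\lambda$ (that is, contained in $\{\nu:\nu\le\mu\}$ for some cardinal $\mu<\lambda$). The ultraproduct carries the linear order of pointwise comparison modulo $\mathcal F$. The pseudopower $\mathrm{pp}_\kappa(\lambda)$ is the supremum of $\mathrm{PP}_\kappa(\lambda)$ (with $\sup\emptyset=0$; the notion is of interest when $\lambda$ is infinite and $\operatorname{cof}\lambda\le\kappa<\lambda$). Theorem. 1. For all cardinals $\kappa,\lambda$, the collection $\mathrm{PP}_\kappa(\lambda)$ is bounded above and $\mathrm{pp}_\kappa(\lambda)\le\lambda^\kappa$. 2. If $\lambda$ is an infinite cardinal with $\operatorname{cof}\lambda\le\kappa<\lambda<\aleph_\lambda$ and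 $\lambda$ is $\kappa$-inaccessible, i.e. $\mu^\kappa<\lambda$ for every cardinal $\mu<\lambda$, then $\mathrm{pp}_\kappa(\lambda)=\lambda^\kappa$. -/

import Mathlib

open Cardinal

universe u

namespace ShelahPP

/-- The reduced product `∏ i, X i / F` of linear orders, ordered by pointwise comparison
modulo `F`; when `F` is an ultrafilter this is the (linearly ordered) ultraproduct. -/
instance reducedProductPartialOrder {ι : Type u} (F : Filter ι) (X : ι → Type u)
    [∀ i, LinearOrder (X i)] : PartialOrder (F.Product X) where
  le p q := Quotient.liftOn₂ p q (fun f g => ∀ᶠ i in F, f i ≤ g i) (by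
    intro f₁ g₁ f₂ g₂ hf hg
    have hf' : ∀ᶠ i in F, f₁ i = f₂ i := hf
    have hg' : ∀ᶠ i in F, g₁ i = g₂ i := hg
    apply propext
    constructor
    · intro h
      filter_upwards [hf', hg', h] with i h1 h2 h3
      rwa [← h1, ← h2]
    · intro h
      filter_upwards [hf', hg', h] with i h1 h2 h3
      rwa [h1, h2])
  le_refl p := Quotient.inductionOn p
    (fun f => (Filter.Eventually.of_forall fun i => le_refl (f i) : ∀ᶠ i in F, f i ≤ f i))
  le_trans p q r := Quotient.inductionOn₃ p q r
    (fun f g h (h1 : ∀ᶠ i in F, f i ≤ g i) (h2 : ∀ᶠ i in F, g i ≤ h i) =>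
      (h1.mp (h2.mono fun _ hgh hfg => le_trans hfg hgh) : ∀ᶠ i in F, f i ≤ h i))
  le_antisymm p q := Quotient.inductionOn₂ p q
    (fun f g (h1 : ∀ᶠ i in F, f i ≤ g i) (h2 : ∀ᶠ i in F, g i ≤ f i) =>
      Quotient.sound (h1.mp (h2.mono fun _ hgf hfg => le_antisymm hfg hgf) :
        ∀ᶠ i in F, f i = g i))

/-- The cofinality of the ultraproduct `∏ i, a i / F` of a family of cardinals, each cardinal
being identified with the well-ordered set of the ordinals below it. -/
noncomputable def ultraproductCof {ι : Type u} (a : ι → Cardinal.{u}) (F : Ultrafilter ι) :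
    Cardinal.{u} :=
  Order.cof ((F : Filter ι).Product fun i => (a i).ord.ToType)

/-- `PP κ l`: the set of cofinalities of the ultraproducts `∏ a / F`, where `a` is a set of at
most `κ` regular cardinals below `l` (enumerated without repetition by a type `ι`) and `F` is an
ultrafilter on `a` that contains no set bounded below `l`. -/
def PP (κ l : Cardinal.{u}) : Set Cardinal.{u} :=
  {c | ∃ (ι : Type u) (a : ι → Cardinal.{u}) (F : Ultrafilter ι),
    Function.Injective a ∧ #ι ≤ κ ∧ (∀ i, (a i).IsRegular ∧ a i < l) ∧
    (∀ s ∈ F, ¬ ∃ μ < l, ∀ i ∈ s, a i ≤ μ) ∧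
    c = ultraproductCof a F}

/-- The pseudopower `pp_κ(l)`. -/
noncomputable def pp (κ l : Cardinal.{u}) : Cardinal.{u} := sSup (PP κ l)

/-- `l` is `κ`-inaccessible. -/
def IsInaccessibleFor (κ l : Cardinal.{u}) : Prop := ∀ μ < l, μ ^ κ < l

end ShelahPP

namespace ShelahPP

open Order Ordinal Filter

/-! Every member of `PP κ l` is at most the size of a product of at most `κ` cardinals below `l`, so
part 1 is a count (`ultraproductCof_le_pow`).

For the lower bound in part 2, write `l = ℵ_ δ`. Since `δ.card < l`, inaccessibility gives `ν < l`
with `ν ^ κ = ν` and at most `ν` successor cardinals in the interval from `ν` to `l`; let `a`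
enumerate them. All ultraproducts of at most `κ` of these have cofinality at most `θ = pp κ l`:
those over unbounded ultrafilters by definition, the others because `μ ^ κ < l ≤ θ` for `μ < l`. It
then suffices to cover all `κ`-sequences of ordinals below `l` by `θ` sets of size at most `ν`,
since each such set carries only `ν ^ κ = ν` sequences (`power_le_of_covering`).

The cover comes from pcf theory (`exists_scales`): each set `A` of coordinates has a scale of some
length `μ A ≤ θ`, modulo an ideal whose members have smaller `μ`. Put the sequence `X` into the
union `U` of a chain of `κ⁺` sets of size `ν` closed under the scales. On a large part of `A`, the
function sending `k` to `sup (U ∩ a k)` depends only on `sup (U ∩ μ A)`; descending in `μ`, finitely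
many of `θ` representatives determine it (`exists_representatives`). These suprema in turn recover
`X`: an ordinal `z ∈ U` is coded, by an injection of some larger `β` into its cardinal, by a smaller
ordinal of `U`, and `β` can be taken from a sequence of length `κ⁺` attached to the supremum alone.
Descent ends below `ν` (`exists_covering`). -/

/-! ### Sections and cofinal families -/

/-- The elements of the product `∏ i, a i`. -/
abbrev Sec {ι : Type u} (a : ι → Cardinal.{u}) : Type (u + 1) :=
  {g : ι → Ordinal.{u} // ∀ i, g i < (a i).ord}

theorem ultraproductCof_le {ι : Type u} {a : ι → Cardinal.{u}} {F : Ultrafilter ι} {J : Type u}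
    (f : J → Sec a) (hf : ∀ g : Sec a, ∃ j, ∀ᶠ i in (F : Filter ι), g.1 i ≤ (f j).1 i) :
    ultraproductCof a F ≤ #J := by
  let q : J → (F : Filter ι).Product (fun i => (a i).ord.ToType) := fun j =>
    Quotient.mk _ (fun i => ToType.mk ⟨(f j).1 i, (f j).2 i⟩)
  refine (Order.cof_le (s := Set.range q) ?_).trans mk_range_le
  intro p
  induction p using Quotient.inductionOn with
  | h g =>
    obtain ⟨j, hj⟩ := hf ⟨fun i => (g i).toOrd, fun i => (g i).toOrd.2⟩
    refine ⟨q j, ⟨j, rfl⟩, ?_⟩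
    change ∀ᶠ i in (F : Filter ι), g i ≤ ToType.mk ⟨(f j).1 i, (f j).2 i⟩
    filter_upwards [hj] with i hi
    rw [← OrderIso.symm_apply_le]
    exact hi

theorem exists_cofinal_sections {ι : Type u} {a : ι → Cardinal.{u}} {F : Ultrafilter ι}
    {μ : Cardinal.{u}} (hμ : ultraproductCof a F = μ) :
    ∃ f : μ.ord.ToType → Sec a,
      ∀ g : Sec a, ∃ j, ∀ᶠ i in (F : Filter ι), g.1 i ≤ (f j).1 i := by
  obtain ⟨s, hs, hc⟩ := Order.exists_cof_eq ((F : Filter ι).Product fun i => (a i).ord.ToType)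
  have : #μ.ord.ToType = #s := by
    rw [mk_ord_toType, hc, ← hμ]; rfl
  obtain ⟨e⟩ := Cardinal.eq.1 this
  refine ⟨fun j => ⟨fun i => ((e j).1.out i).toOrd, fun i => ((e j).1.out i).toOrd.2⟩, ?_⟩
  intro g
  obtain ⟨y, hy, hgy⟩ := hs (Quotient.mk _ (fun i => ToType.mk ⟨g.1 i, g.2 i⟩))
  refine ⟨e.symm ⟨y, hy⟩, ?_⟩
  rw [← y.out_eq] at hgy
  have h : ∀ᶠ i in (F : Filter ι), ToType.mk ⟨g.1 i, g.2 i⟩ ≤ y.out i := hgy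
  filter_upwards [h] with i hi
  rw [← OrderIso.le_symm_apply] at hi
  rw [e.apply_symm_apply]
  exact hi

theorem ultraproductCof_le_pow {ι : Type u} {a : ι → Cardinal.{u}} (ha : ∀ i, (a i).IsRegular)
    {F : Ultrafilter ι} {s : Set ι} (hs : s ∈ F) {τ : Cardinal.{u}} (hτ : ∀ i ∈ s, a i ≤ τ) :
    ultraproductCof a F ≤ τ ^ #ι := by
  classical
  -- Values that are too large are replaced by 0; this is harmless, since only sections have to be
  -- dominated.
  let f : (ι → τ.ord.ToType) → Sec a := fun j =>
    ⟨fun i => if ((j i).toOrd : Ordinal) < (a i).ord then ((j i).toOrd : Ordinal) else 0,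
      fun i => by
        dsimp only
        split_ifs with h
        exacts [h, (ha i).ord_pos]⟩
  obtain ⟨i₀, hi₀⟩ := F.nonempty_of_mem hs
  have hτ0 : 0 < τ.ord := (ha i₀).ord_pos.trans_le (ord_le_ord.2 (hτ i₀ hi₀))
  refine (ultraproductCof_le f ?_).trans (by simp)
  intro g
  refine ⟨fun i => if h : g.1 i < τ.ord then ToType.mk ⟨g.1 i, h⟩ else ToType.mk ⟨0, hτ0⟩, ?_⟩
  filter_upwards [hs] with i hi
  have h : g.1 i < τ.ord := (g.2 i).trans_le (ord_le_ord.2 (hτ i hi))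
  simp [f, h, g.2 i]

theorem exists_forall_lt {ι : Type u} {a : ι → Cardinal.{u}} (ha : ∀ i, (a i).IsRegular)
    {J : Type u} (hJ : ∀ i, #J < a i) (f : J → Sec a) :
    ∃ g : Sec a, ∀ j i, (f j).1 i < g.1 i := by
  refine ⟨⟨fun i => ⨆ j, (f j).1 i + 1, fun i => ?_⟩, fun j i => ?_⟩
  · refine Ordinal.iSup_lt_of_lt_cof (by rw [(ha i).cof_ord]; exact hJ i) fun j => ?_
    exact (isSuccLimit_ord (ha i).aleph0_le).succ_lt ((f j).2 i)
  · exact (lt_add_one _).trans_le (Ordinal.le_iSup (fun j => (f j).1 i + 1) j)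

theorem exists_lt_sec {ι : Type u} {a : ι → Cardinal.{u}} (ha : ∀ i, (a i).IsRegular)
    (f : Sec a) : ∃ g : Sec a, ∀ i, f.1 i < g.1 i := by
  obtain ⟨g, hg⟩ := exists_forall_lt ha (J := PUnit) (fun i => by simpa using (ha i).nat_lt 1) fun _ => f
  exact ⟨g, hg ⟨⟩⟩

theorem exists_recursive {I : Type*} [LinearOrder I] [WellFoundedLT I] {α : Type*}
    (P : ∀ i : I, ({j // j < i} → α) → α → Prop) (h : ∀ i F, ∃ x, P i F x) :
    ∃ g : I → α, ∀ i, P i (fun j => g j.1) (g i) := by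
  choose c hc using h
  refine ⟨wellFounded_lt.fix fun i r => c i fun j => r j.1 j.2, fun i => ?_⟩
  rw [WellFounded.fix_eq]
  exact hc i _

theorem mk_subtype_lt_le {c : Cardinal.{u}} (i : c.ord.ToType) : #{j // j < i} < c :=
  (Cardinal.mk_Iio_lt i (by simp)).trans_eq (mk_ord_toType c)

/-! ### Pcf theory: directedness, maximal cofinalities and scales -/

/-- An increasing sequence that no section dominates in the sense of `P` is cofinal on some set
satisfying `P`. -/
theorem exists_cofinal_piece {ι : Type u} {a : ι → Cardinal.{u}} {κ : Cardinal.{u}}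
    (hι : #ι ≤ κ) (ha : ∀ i, (a i).IsRegular) (hκa : ∀ i, succ κ < a i)
    {T : Type*} [LinearOrder T] (hT : ∀ φ : (succ κ).ord.ToType → T, ∃ t, ∀ i, φ i ≤ t)
    (G : Filter ι) (f : T → Sec a)
    (hf : ∀ s t, s ≤ t → ∀ᶠ x in G, (f s).1 x ≤ (f t).1 x) (P : Set ι → Prop)
    (hP : ∀ g : Sec a, ∃ t, P {x | g.1 x < (f t).1 x}) :
    ∃ B, P B ∧ ∀ g : Sec a, ∃ t, ∀ᶠ x in G, x ∈ B → g.1 x < (f t).1 x := by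
  by_contra! hcon
  choose t ht using hP
  choose H hH using fun g => hcon _ (ht g)
  -- If no piece is cofinal, `H g` witnesses the failure for the piece attached to `g`. Build `κ⁺`
  -- sections, each pointwise above the earlier `g j` and `H (g j)`. With one index `s` beyond all
  -- `t (g i)`, each `i` yields a coordinate `x i` where `f s` lies above `g i` but not above `H (g
  -- i)`; these are distinct, too many for `ι`.
  obtain ⟨g, hg⟩ := exists_recursive (I := (succ κ).ord.ToType) (α := Sec a)
    (fun i F x => ∀ j y, max ((F j).1 y) ((H (F j)).1 y) < x.1 y) (by
      intro i F
      exact exists_forall_lt ha (fun x => (mk_subtype_lt_le i).trans (hκa x))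
        (fun j => ⟨fun y => max ((F j).1 y) ((H (F j)).1 y),
          fun y => max_lt ((F j).2 y) ((H (F j)).2 y)⟩))
  obtain ⟨s, hs⟩ := hT fun i => t (g i)
  have key : ∀ i, ∃ x, (g i).1 x < (f s).1 x ∧ (f s).1 x ≤ (H (g i)).1 x := by
    intro i
    have h1 := hH (g i) s
    obtain ⟨x, hx1, hx2⟩ := (h1.and_eventually (hf _ _ (hs i))).exists
    exact ⟨x, lt_of_lt_of_le hx1.1 hx2, hx1.2⟩
  choose x hx1 hx2 using key
  have hne : ∀ i j, i < j → x i ≠ x j := by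
    intro i j hij he
    have h1 := hg j ⟨i, hij⟩ (x i)
    have h2 := hx1 j
    rw [← he] at h2
    exact absurd ((hx2 i).trans_lt ((le_max_right _ _).trans_lt h1)) h2.not_gt
  have hinj : Function.Injective x := by
    intro i j he
    rcases lt_trichotomy i j with h | h | h
    · exact absurd he (hne i j h)
    · exact h
    · exact absurd he.symm (hne j i h)
  have := mk_le_of_injective hinj
  rw [mk_ord_toType] at this
  exact absurd (this.trans hι) (lt_succ κ).not_ge

/-- The filter of the sets that belong to every ultrafilter whose ultraproduct has cofinality
at least `μ`. -/
def largeFilter {ι : Type u} (a : ι → Cardinal.{u}) (μ : Cardinal.{u}) : Filter ι :=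
  ⨆ F ∈ {F : Ultrafilter ι | μ ≤ ultraproductCof a F}, (F : Filter ι)

theorem mem_largeFilter {ι : Type u} {a : ι → Cardinal.{u}} {μ : Cardinal.{u}} {s : Set ι} :
    s ∈ largeFilter a μ ↔ ∀ F : Ultrafilter ι, μ ≤ ultraproductCof a F → s ∈ F := by
  simp [largeFilter, Filter.mem_iSup]

theorem le_largeFilter {ι : Type u} {a : ι → Cardinal.{u}} {μ : Cardinal.{u}} {F : Ultrafilter ι}
    (h : μ ≤ ultraproductCof a F) : (F : Filter ι) ≤ largeFilter a μ :=
  fun _ hs => mem_largeFilter.1 hs F h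

theorem largeFilter_anti {ι : Type u} {a : ι → Cardinal.{u}} {μ μ' : Cardinal.{u}} (h : μ ≤ μ') :
    largeFilter a μ' ≤ largeFilter a μ :=
  fun _ hs => mem_largeFilter.2 fun F hF => mem_largeFilter.1 hs F (h.trans hF)

section PCF

variable {ι : Type u} {a : ι → Cardinal.{u}} {κ : Cardinal.{u}}
  (hι : #ι ≤ κ) (ha : ∀ i, (a i).IsRegular) (hκa : ∀ i, succ κ < a i)

/-- Only proper initial segments need bounds, so for `T` a cardinal, bounds for families of smaller
size suffice. -/
theorem monotonize {T : Type u} [LinearOrder T] [WellFoundedLT T] {G : Filter ι}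
    (hb : ∀ (t : T) (F : {s // s < t} → Sec a), ∃ g : Sec a, ∀ s, ∀ᶠ x in G, (F s).1 x ≤ g.1 x)
    (f : T → Sec a) :
    ∃ f' : T → Sec a, (∀ t x, (f t).1 x ≤ (f' t).1 x) ∧
      ∀ s t, s ≤ t → ∀ᶠ x in G, (f' s).1 x ≤ (f' t).1 x := by
  obtain ⟨f', hf'⟩ := exists_recursive (I := T) (α := Sec a)
    (fun t F g => (∀ x, (f t).1 x ≤ g.1 x) ∧ ∀ s, ∀ᶠ x in G, (F s).1 x ≤ g.1 x) (by
      intro t F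
      obtain ⟨g, hg⟩ := hb t F
      refine ⟨⟨fun x => max ((f t).1 x) (g.1 x), fun x => max_lt ((f t).2 x) (g.2 x)⟩,
        fun x => le_max_left _ _, fun s => ?_⟩
      filter_upwards [hg s] with x hx using hx.trans (le_max_right _ _))
  refine ⟨f', fun t => (hf' t).1, fun s t hst => ?_⟩
  rcases hst.eq_or_lt with rfl | h
  · exact Eventually.of_forall fun _ => le_rfl
  · exact (hf' t).2 ⟨s, h⟩

include hι ha hκa

/-- The product is `μ`-directed modulo `largeFilter a μ`. An unbounded increasing family of size
below `μ` would be cofinal on a positive set, hence in an ultraproduct of cofinality at least `μ`.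
-/
theorem exists_bound_largeFilter (μ : Cardinal.{u}) (J : Type u) (hJ : #J < μ) (f : J → Sec a) :
    ∃ g : Sec a, ∀ j, ∀ᶠ x in largeFilter a μ, (f j).1 x ≤ g.1 x := by
  induction hc : #J using WellFoundedLT.induction generalizing J with
  | _ c IH =>
  subst hc
  let T := (#J).ord.ToType
  obtain ⟨e⟩ : Nonempty (T ≃ J) := Cardinal.eq.1 (mk_ord_toType _)
  obtain ⟨f', hf', hmono⟩ := monotonize (T := T) (G := largeFilter a μ) (fun t F =>
    IH _ (mk_subtype_lt_le t) _ ((mk_subtype_lt_le t).trans hJ) F rfl) (fun t => f (e t))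
  suffices h : ∃ g : Sec a, ∀ t, ∀ᶠ x in largeFilter a μ, (f' t).1 x ≤ g.1 x by
    obtain ⟨g, hg⟩ := h
    refine ⟨g, fun j => ?_⟩
    filter_upwards [hg (e.symm j)] with x hx
    simpa using (hf' (e.symm j) x).trans hx
  -- Otherwise some `κ⁺` indices are unbounded in `T`, and a pointwise supremum of `κ⁺` sections
  -- exists because `succ κ < a i`.
  by_cases hT : ∀ φ : (succ κ).ord.ToType → T, ∃ t, ∀ i, φ i ≤ t
  · by_contra! hcon
    obtain ⟨B, hB, hcof⟩ := exists_cofinal_piece hι ha hκa hT (largeFilter a μ) f' hmono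
      (fun B => Bᶜ ∉ largeFilter a μ) (by
        intro g
        obtain ⟨t, ht⟩ := hcon g
        refine ⟨t, fun h => ?_⟩
        refine ht ?_
        filter_upwards [h] with x hx
        simpa using hx)
    rw [mem_largeFilter] at hB
    push Not at hB
    obtain ⟨F, hF, hBF⟩ := hB
    have hBF' : B ∈ F := by simpa [Ultrafilter.compl_mem_iff_notMem] using hBF
    have : ultraproductCof a F ≤ #T := by
      refine ultraproductCof_le f' fun g => ?_
      obtain ⟨t, ht⟩ := hcof g
      refine ⟨t, ?_⟩
      filter_upwards [le_largeFilter hF ht, hBF'] with x h1 h2 using (h1 h2).le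
    rw [mk_ord_toType] at this
    exact absurd (hF.trans this) hJ.not_ge
  · push Not at hT
    obtain ⟨φ, hφ⟩ := hT
    obtain ⟨g, hg⟩ := exists_forall_lt ha (J := (succ κ).ord.ToType)
      (by simpa using hκa) (fun i => f' (φ i))
    refine ⟨g, fun t => ?_⟩
    obtain ⟨i, hi⟩ := hφ t
    filter_upwards [hmono _ _ hi.le] with x hx using hx.trans (hg i x).le

theorem le_ultraproductCof_of_le_largeFilter {μ : Cardinal.{u}} {F : Ultrafilter ι}
    (hF : (F : Filter ι) ≤ largeFilter a μ) : μ ≤ ultraproductCof a F := by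
  by_contra! h
  obtain ⟨f, hf⟩ := exists_cofinal_sections (a := a) (F := F) rfl
  obtain ⟨g, hg⟩ := exists_bound_largeFilter hι ha hκa μ _ (by simpa using h) f
  obtain ⟨g', hg'⟩ := exists_lt_sec ha g
  obtain ⟨j, hj⟩ := hf g'
  obtain ⟨x, h1, h2⟩ := (hj.and (hF (hg j))).exists
  exact absurd ((hg' x).trans_le (h1.trans h2)) (lt_irrefl _)

/-- A compactness argument: the filters `largeFilter` decrease as the cofinality grows, so together
with `A` they generate a proper filter, and any ultrafilter extending it attains the maximum. -/
theorem exists_max_ultraproductCof {A : Set ι} (hA : A.Nonempty) :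
    ∃ F : Ultrafilter ι, A ∈ F ∧
      ∀ F' : Ultrafilter ι, A ∈ F' → ultraproductCof a F' ≤ ultraproductCof a F := by
  let S := {F : Ultrafilter ι // A ∈ F}
  obtain ⟨x, hx⟩ := hA
  have : Nonempty S := ⟨⟨pure x, hx⟩⟩
  let Γ : S → Filter ι := fun F => largeFilter a (ultraproductCof a F.1) ⊓ 𝓟 A
  have hΓ : ∀ F : S, (F.1 : Filter ι) ≤ Γ F := fun F =>
    le_inf (le_largeFilter le_rfl) (le_principal_iff.2 F.2)
  have hne : (⨅ F, Γ F).NeBot := by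
    refine iInf_neBot_of_directed' ?_ fun F => neBot_of_le (hΓ F)
    intro F F'
    rcases le_total (ultraproductCof a F.1) (ultraproductCof a F'.1) with h | h
    · exact ⟨F', inf_le_inf_right _ (largeFilter_anti h), le_rfl⟩
    · exact ⟨F, le_rfl, inf_le_inf_right _ (largeFilter_anti h)⟩
  have hle : ∀ F : S, (Ultrafilter.of (⨅ F, Γ F) : Filter ι) ≤ Γ F := fun F =>
    (Ultrafilter.of_le _).trans (iInf_le Γ F)
  refine ⟨Ultrafilter.of (⨅ F, Γ F), ?_, fun F' hF' => ?_⟩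
  · exact le_principal_iff.1 ((hle ⟨pure x, hx⟩).trans inf_le_right)
  · exact le_ultraproductCof_of_le_largeFilter hι ha hκa ((hle ⟨F', hF'⟩).trans inf_le_left)

/-- Relative to `largeFilter`, the ultraproducts of maximal cofinality have a scale of that length. -/
theorem exists_scale {A : Set ι} {μ : Cardinal.{u}}
    (hne : ∃ F : Ultrafilter ι, A ∈ F ∧ ultraproductCof a F = μ)
    (hμ : ∀ F : Ultrafilter ι, A ∈ F → ultraproductCof a F ≤ μ) :
    ∃ f : μ.ord.ToType → Sec a, ∀ g : Sec a, ∃ t₀, ∀ t, t₀ ≤ t →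
      ∀ᶠ x in largeFilter a μ ⊓ 𝓟 A, g.1 x ≤ (f t).1 x := by
  let T := μ.ord.ToType
  have hT0 : Nonempty T := by
    obtain ⟨F, -, hF⟩ := hne
    obtain ⟨f, hf⟩ := exists_cofinal_sections hF
    obtain ⟨j, -⟩ := hf ⟨fun _ => 0, fun i => (ha i).ord_pos⟩
    exact ⟨j⟩
  let G := largeFilter a μ ⊓ 𝓟 A
  let good : Set ι → Prop := fun S => ∃ f : T → Sec a, ∀ g : Sec a, ∃ t₀, ∀ t, t₀ ≤ t →
      ∀ᶠ x in G, x ∉ S → g.1 x ≤ (f t).1 x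
  -- The sets off which a scale exists form a filter. Were it proper, an ultrafilter extending it
  -- would have cofinality `μ`, and a cofinal piece belonging to that ultrafilter would have its
  -- complement in `C`.
  let C : Filter ι :=
    { sets := {S | good S}
      univ_sets := ⟨fun _ => ⟨fun _ => 0, fun i => (ha i).ord_pos⟩, fun g =>
        ⟨hT0.some, fun t _ => Eventually.of_forall fun x hx => absurd (Set.mem_univ x) hx⟩⟩
      sets_of_superset := by
        rintro S S' ⟨f, hf⟩ hSS
        refine ⟨f, fun g => ?_⟩
        obtain ⟨t₀, ht₀⟩ := hf g
        refine ⟨t₀, fun t ht => ?_⟩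
        filter_upwards [ht₀ t ht] with x hx hxS using hx fun h => hxS (hSS h)
      inter_sets := by
        rintro S S' ⟨f, hf⟩ ⟨f', hf'⟩
        refine ⟨fun t => ⟨fun x => max ((f t).1 x) ((f' t).1 x),
          fun x => max_lt ((f t).2 x) ((f' t).2 x)⟩, fun g => ?_⟩
        obtain ⟨t₀, ht₀⟩ := hf g
        obtain ⟨t₁, ht₁⟩ := hf' g
        refine ⟨max t₀ t₁, fun t ht => ?_⟩
        filter_upwards [ht₀ t ((le_max_left _ _).trans ht), ht₁ t ((le_max_right _ _).trans ht)]
          with x h1 h2 hx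
        by_cases h : x ∈ S
        · exact (h2 fun h' => hx ⟨h, h'⟩).trans (le_max_right _ _)
        · exact (h1 h).trans (le_max_left _ _) }
  by_cases hC : good ∅
  · obtain ⟨f, hf⟩ := hC
    refine ⟨f, fun g => ?_⟩
    obtain ⟨t₀, ht₀⟩ := hf g
    refine ⟨t₀, fun t ht => ?_⟩
    filter_upwards [ht₀ t ht] with x hx using hx (Set.notMem_empty x)
  exfalso
  have : C.NeBot := ⟨fun h => hC (show (∅ : Set ι) ∈ C by rw [h]; trivial)⟩
  let F := Ultrafilter.of C
  have hFC : (F : Filter ι) ≤ C := Ultrafilter.of_le C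
  have hCG : C ≤ G := by
    intro S hS
    refine ⟨fun _ => ⟨fun _ => 0, fun i => (ha i).ord_pos⟩, fun g => ⟨hT0.some, fun t _ => ?_⟩⟩
    filter_upwards [hS] with x hx hx' using absurd hx hx'
  have hFG : (F : Filter ι) ≤ largeFilter a μ := hFC.trans (hCG.trans inf_le_left)
  have hFA : A ∈ F := le_principal_iff.1 (hFC.trans (hCG.trans inf_le_right))
  have hcof : ultraproductCof a F = μ :=
    (hμ F hFA).antisymm (le_ultraproductCof_of_le_largeFilter hι ha hκa hFG)
  obtain ⟨f, hf⟩ := exists_cofinal_sections hcof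
  obtain ⟨f', hf', hmono⟩ := monotonize (T := T) (G := largeFilter a μ) (fun t F =>
    exists_bound_largeFilter hι ha hκa μ _ (mk_subtype_lt_le t) F) f
  have hcof' : ∀ g : Sec a, ∃ t, ∀ᶠ x in (F : Filter ι), g.1 x ≤ (f' t).1 x := by
    intro g
    obtain ⟨t, ht⟩ := hf g
    refine ⟨t, ?_⟩
    filter_upwards [ht] with x hx using hx.trans (hf' t x)
  have hT : ∀ φ : (succ κ).ord.ToType → T, ∃ t, ∀ i, φ i ≤ t := by
    intro φ
    by_contra! hcon
    obtain ⟨g, hg⟩ := exists_forall_lt ha (J := (succ κ).ord.ToType)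
      (by simpa using hκa) (fun i => f' (φ i))
    obtain ⟨t, ht⟩ := hcof' g
    obtain ⟨i, hi⟩ := hcon t
    obtain ⟨x, h1, h2⟩ := (ht.and (hFG (hmono _ _ hi.le))).exists
    exact absurd (h1.trans h2) (hg i x).not_ge
  obtain ⟨B, hB, hBcof⟩ := exists_cofinal_piece hι ha hκa hT (largeFilter a μ) f' hmono
    (fun B => B ∈ F) (by
      intro g
      obtain ⟨g', hg'⟩ := exists_lt_sec ha g
      obtain ⟨t, ht⟩ := hcof' g'
      refine ⟨t, ?_⟩
      filter_upwards [ht] with x hx using (hg' x).trans_le hx)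
  have hBC : Bᶜ ∈ C := by
    refine ⟨f', fun g => ?_⟩
    obtain ⟨t₀, ht₀⟩ := hBcof g
    refine ⟨t₀, fun t ht => Filter.Eventually.filter_mono inf_le_left ?_⟩
    filter_upwards [ht₀, hmono _ _ ht] with x h1 h2 hx
    exact ((h1 (by simpa using hx)).trans_le h2).le
  exact Ultrafilter.compl_notMem_iff.2 hB (hFC hBC)

/-- Every nonempty set of coordinates carries a filter with a scale, whose length is a cofinality
and strictly decreases when a large set of coordinates is removed. -/
theorem exists_scales :
    ∃ (μ : Set ι → Cardinal.{u}) (G : Set ι → Filter ι) (f : ∀ A, (μ A).ord.ToType → Sec a),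
      (∀ A, A.Nonempty → ∃ F : Ultrafilter ι, μ A = ultraproductCof a F) ∧
      (∀ A, A.Nonempty → ∀ g : Sec a, ∃ t₀, ∀ t, t₀ ≤ t → ∀ᶠ x in G A, g.1 x ≤ (f A t).1 x) ∧
      ∀ A, A.Nonempty → ∀ B ∈ G A, (A \ B).Nonempty → μ (A \ B) < μ A := by
  have h : ∀ A : Set ι, ∃ (μ : Cardinal.{u}) (f : μ.ord.ToType → Sec a), A.Nonempty →
      (∃ F : Ultrafilter ι, A ∈ F ∧ ultraproductCof a F = μ) ∧
      (∀ F : Ultrafilter ι, A ∈ F → ultraproductCof a F ≤ μ) ∧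
      ∀ g : Sec a, ∃ t₀, ∀ t, t₀ ≤ t →
        ∀ᶠ x in largeFilter a μ ⊓ 𝓟 A, g.1 x ≤ (f t).1 x := by
    intro A
    by_cases hA : A.Nonempty
    · obtain ⟨F, hF, hmax⟩ := exists_max_ultraproductCof hι ha hκa hA
      obtain ⟨f, hf⟩ := exists_scale hι ha hκa ⟨F, hF, rfl⟩ hmax
      exact ⟨_, f, fun _ => ⟨⟨F, hF, rfl⟩, hmax, hf⟩⟩
    · exact ⟨0, fun _ => ⟨fun _ => 0, fun i => (ha i).ord_pos⟩, fun h => absurd h hA⟩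
  choose μ f h using h
  refine ⟨μ, fun A => largeFilter a (μ A) ⊓ 𝓟 A, f, fun A hA => ?_, fun A hA => (h A hA).2.2,
    fun A hA B hB hAB => ?_⟩
  · obtain ⟨F, -, hF⟩ := (h A hA).1
    exact ⟨F, hF.symm⟩
  · obtain ⟨F, hF, hFμ⟩ := (h _ hAB).1
    have hAF : A ∈ F := F.toFilter.sets_of_superset hF Set.sdiff_subset
    rw [← hFμ]
    refine lt_of_le_of_ne ((h A hA).2.1 F hAF) fun heq => ?_
    -- Equal cofinality would make `F` extend the filter of `A`, which contains `B`; but `F`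
    -- contains `A \ B`.
    have hBF : B ∈ F := (le_inf (le_largeFilter heq.ge) (le_principal_iff.2 hAF)) hB
    obtain ⟨x, hx1, hx2⟩ := F.nonempty_of_mem (inter_mem hF hBF)
    exact hx1.2 hx2

end PCF

/-! ### Sequences of length `κ⁺` -/

section WellOrder

variable {κ : Cardinal.{u}} (hκ : ℵ₀ ≤ κ)

include hκ

theorem exists_forall_lt_succ_ord {J : Type u} (hJ : #J ≤ κ) (φ : J → (succ κ).ord.ToType) :
    ∃ i, ∀ j, φ j < i := by
  have hreg := isRegular_succ hκ
  have h : (⨆ j, ((φ j).toOrd : Ordinal) + 1) < (succ κ).ord := by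
    refine Ordinal.iSup_lt_of_lt_cof ?_ fun j => ?_
    · rw [hreg.cof_ord]
      exact lt_succ_of_le hJ
    · exact (isSuccLimit_ord hreg.aleph0_le).succ_lt (φ j).toOrd.2
  refine ⟨ToType.mk ⟨_, h⟩, fun j => ?_⟩
  rw [← OrderIso.symm_apply_lt, ← Subtype.coe_lt_coe]
  exact (lt_add_one _).trans_le (Ordinal.le_iSup (fun j => ((φ j).toOrd : Ordinal) + 1) j)

theorem exists_gt_succ_ord (i : (succ κ).ord.ToType) : ∃ j, i < j := by
  obtain ⟨j, hj⟩ := exists_forall_lt_succ_ord hκ (J := PUnit)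
    (by simpa using one_le_aleph0.trans hκ) fun _ => i
  exact ⟨j, hj ⟨⟩⟩

theorem exists_isLUB_seq (φ : ℕ → (succ κ).ord.ToType) : ∃ i, IsLUB (Set.range φ) i := by
  obtain ⟨i, hi⟩ := exists_forall_lt_succ_ord hκ (J := ULift.{u} ℕ)
    (by simpa using hκ) fun n => φ n.down
  have hne : (upperBounds (Set.range φ)).Nonempty :=
    ⟨i, by rintro _ ⟨n, rfl⟩; exact (hi ⟨n⟩).le⟩
  exact ⟨wellFounded_lt.min _ hne, wellFounded_lt.min_mem _ hne,
    fun j hj => wellFounded_lt.min_le hj⟩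

/-- Each point outside the intersection leaves at some stage, and at most `κ` stages are bounded in
`κ⁺`. -/
theorem exists_subset_iInter {ι : Type u} (hι : #ι ≤ κ) {A : (succ κ).ord.ToType → Set ι}
    (hA : ∀ i j, i ≤ j → A j ⊆ A i) : ∃ i, A i ⊆ ⋂ j, A j := by
  have h : ∀ x, ∃ i, x ∈ A i → x ∈ ⋂ j, A j := by
    intro x
    by_cases hx : x ∈ ⋂ j, A j
    · exact ⟨ToType.mk ⟨0, (isRegular_succ hκ).ord_pos⟩, fun _ => hx⟩
    · obtain ⟨i, hi⟩ : ∃ i, x ∉ A i := by simpa using hx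
      exact ⟨i, fun h => absurd h hi⟩
  choose φ hφ using h
  obtain ⟨i, hi⟩ := exists_forall_lt_succ_ord hκ hι φ
  exact ⟨i, fun x hx => hφ x (hA _ _ (hi x).le hx)⟩

/-- Two interleaved continuous sequences of length `κ⁺` have arbitrarily large common values. -/
theorem exists_common_value {u v : (succ κ).ord.ToType → Ordinal.{u}}
    (hu : Monotone u) (hv : Monotone v) (huv : ∀ i, ∃ j, u i ≤ v j) (hvu : ∀ j, ∃ i, v j ≤ u i)
    (hu' : ∀ (φ : ℕ → (succ κ).ord.ToType) i, StrictMono φ → IsLUB (Set.range φ) i →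
      ∀ y < u i, ∃ n, y < u (φ n))
    (hv' : ∀ (φ : ℕ → (succ κ).ord.ToType) i, StrictMono φ → IsLUB (Set.range φ) i →
      ∀ y < v i, ∃ n, y < v (φ n))
    {x : Ordinal.{u}} (hx : ∃ i, x < u i) : ∃ i j, u i = v j ∧ x < u i := by
  have huv' : ∀ i j₀, ∃ j, u i ≤ v j ∧ j₀ < j := by
    intro i j₀
    obtain ⟨j, hj⟩ := huv i
    obtain ⟨j', hj'⟩ := exists_gt_succ_ord hκ (max j j₀)
    exact ⟨j', hj.trans (hv ((le_max_left _ _).trans hj'.le)), (le_max_right _ _).trans_lt hj'⟩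
  have hvu' : ∀ j i₀, ∃ i, v j ≤ u i ∧ i₀ < i := by
    intro j i₀
    obtain ⟨i, hi⟩ := hvu j
    obtain ⟨i', hi'⟩ := exists_gt_succ_ord hκ (max i i₀)
    exact ⟨i', hi.trans (hu ((le_max_left _ _).trans hi'.le)), (le_max_right _ _).trans_lt hi'⟩
  choose J hJ hJ' using huv'
  choose I hI hI' using hvu'
  obtain ⟨i₀, hi₀⟩ := hx
  -- Alternate between the two sequences `ω` times; by continuity both reach the same limit.
  let p : ℕ → (succ κ).ord.ToType × (succ κ).ord.ToType := fun n =>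
    n.rec (i₀, J i₀ i₀) fun _ q => (I q.2 q.1, J (I q.2 q.1) q.2)
  have hp1 : StrictMono fun n => (p n).1 := strictMono_nat_of_lt_succ fun n => hI' _ _
  have hp2 : StrictMono fun n => (p n).2 := strictMono_nat_of_lt_succ fun n => hJ' _ _
  have hp3 : ∀ n, u (p n).1 ≤ v (p n).2 := by
    rintro (_ | n)
    · exact hJ _ _
    · exact hJ _ _
  have hp4 : ∀ n, v (p n).2 ≤ u (p (n + 1)).1 := fun n => hI _ _
  obtain ⟨i, hi⟩ := exists_isLUB_seq hκ fun n => (p n).1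
  obtain ⟨j, hj⟩ := exists_isLUB_seq hκ fun n => (p n).2
  refine ⟨i, j, le_antisymm ?_ ?_, hi₀.trans_le (hu (hi.1 ⟨0, rfl⟩))⟩
  · refine le_of_forall_lt fun y hy => ?_
    obtain ⟨n, hn⟩ := hu' _ i hp1 hi y hy
    exact hn.trans_le ((hp3 n).trans (hv (hj.1 ⟨n, rfl⟩)))
  · refine le_of_forall_lt fun y hy => ?_
    obtain ⟨n, hn⟩ := hv' _ j hp2 hj y hy
    exact hn.trans_le ((hp4 n).trans (hu (hi.1 ⟨n + 1, rfl⟩)))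

end WellOrder

/-! ### Small sets and closed chains -/

/-- A set of ordinals enumerated by a type of cardinality at most `ν`. -/
def SmallSet (ν : Cardinal.{u}) (N : Set Ordinal.{u}) : Prop :=
  ∃ (J : Type u) (φ : J → Ordinal.{u}), #J ≤ ν ∧ N ⊆ Set.range φ

/-- The least strict upper bound of the part of `N` below `o`. -/
noncomputable def supBelow (N : Set Ordinal.{u}) (o : Ordinal.{u}) : Ordinal.{u} :=
  sSup ((fun x => x + 1) '' (N ∩ Set.Iio o))

theorem bddAbove_supBelow (N : Set Ordinal.{u}) (o : Ordinal.{u}) :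
    BddAbove ((fun x => x + 1) '' (N ∩ Set.Iio o)) := by
  refine ⟨o, ?_⟩
  rintro _ ⟨x, hx, rfl⟩
  exact succ_le_of_lt hx.2

theorem supBelow_le {N : Set Ordinal.{u}} {o c : Ordinal.{u}} (h : ∀ x ∈ N, x < o → x < c) :
    supBelow N o ≤ c := by
  refine csSup_le' ?_
  rintro _ ⟨x, hx, rfl⟩
  exact succ_le_of_lt (h x hx.1 hx.2)

theorem lt_supBelow {N : Set Ordinal.{u}} {o x : Ordinal.{u}} (hx : x ∈ N) (hxo : x < o) :
    x < supBelow N o :=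
  (lt_add_one x).trans_le (le_csSup (bddAbove_supBelow N o) ⟨x, ⟨hx, hxo⟩, rfl⟩)

theorem exists_le_of_lt_supBelow {N : Set Ordinal.{u}} {o x : Ordinal.{u}}
    (h : x < supBelow N o) : ∃ y ∈ N, y < o ∧ x ≤ y := by
  by_contra! hcon
  exact absurd (supBelow_le (c := x) hcon) h.not_ge

theorem supBelow_mono {N N' : Set Ordinal.{u}} (h : N ⊆ N') (o : Ordinal.{u}) :
    supBelow N o ≤ supBelow N' o :=
  supBelow_le fun _ hx hxo => lt_supBelow (h hx) hxo

theorem supBelow_le_self (N : Set Ordinal.{u}) (o : Ordinal.{u}) : supBelow N o ≤ o :=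
  supBelow_le fun _ _ h => h

theorem supBelow_lt {ν c : Cardinal.{u}} (hc : c.IsRegular) (hν : ν < c) {N : Set Ordinal.{u}}
    (hN : SmallSet ν N) : supBelow N c.ord < c.ord := by
  classical
  obtain ⟨J, φ, hJ, hNφ⟩ := hN
  have h : (⨆ j, if φ j < c.ord then φ j + 1 else 0) < c.ord := by
    refine Ordinal.iSup_lt_of_lt_cof ?_ fun j => ?_
    · rw [hc.cof_ord]
      exact hJ.trans_lt hν
    · split_ifs with h
      · exact (isSuccLimit_ord hc.aleph0_le).succ_lt h
      · exact hc.ord_pos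
  refine (supBelow_le fun x hx hxc => ?_).trans_lt h
  obtain ⟨j, rfl⟩ := hNφ hx
  refine lt_of_lt_of_le ?_ (Ordinal.le_iSup (fun j => if φ j < c.ord then φ j + 1 else 0) j)
  rw [if_pos hxc]
  exact lt_add_one _

namespace SmallSet

variable {ν : Cardinal.{u}} {N N' : Set Ordinal.{u}}

theorem range {J : Type u} (hJ : #J ≤ ν) (φ : J → Ordinal.{u}) : SmallSet ν (Set.range φ) :=
  ⟨J, φ, hJ, le_rfl⟩

theorem iUnion (hν : ℵ₀ ≤ ν) {J : Type u} (hJ : #J ≤ ν) {M : J → Set Ordinal.{u}}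
    (hM : ∀ j, SmallSet ν (M j)) : SmallSet ν (⋃ j, M j) := by
  choose T φ hT hφ using hM
  refine ⟨Σ j, T j, fun p => φ p.1 p.2, ?_, ?_⟩
  · rw [mk_sigma]
    refine (sum_le_sum _ (fun _ => ν) hT).trans ?_
    rw [sum_const']
    exact mul_le_of_le hν hJ le_rfl
  · refine Set.iUnion_subset fun j x hx => ?_
    obtain ⟨t, rfl⟩ := hφ j hx
    exact ⟨⟨j, t⟩, rfl⟩

theorem union (hν : ℵ₀ ≤ ν) (h : SmallSet ν N) (h' : SmallSet ν N') : SmallSet ν (N ∪ N') := by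
  obtain ⟨J, φ, hJ, hφ⟩ := h
  obtain ⟨J', φ', hJ', hφ'⟩ := h'
  refine ⟨J ⊕ J', Sum.elim φ φ', ?_, ?_⟩
  · simpa using add_le_of_le hν hJ hJ'
  · rw [Set.Sum.elim_range]
    exact Set.union_subset_union hφ hφ'

theorem image2 (hν : ℵ₀ ≤ ν) (h : SmallSet ν N) {V : Type u} (hV : #V ≤ ν)
    (op : V → Ordinal.{u} → Ordinal.{u} → Ordinal.{u}) :
    SmallSet ν {y | ∃ v, ∃ x ∈ N, ∃ z ∈ N, op v x z = y} := by
  obtain ⟨J, φ, hJ, hφ⟩ := h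
  refine ⟨V × J × J, fun p => op p.1 (φ p.2.1) (φ p.2.2), ?_, ?_⟩
  · simp only [mk_prod, Cardinal.lift_id]
    exact mul_le_of_le hν hV (mul_le_of_le hν hJ hJ)
  · rintro _ ⟨v, x, hx, z, hz, rfl⟩
    obtain ⟨j, rfl⟩ := hφ hx
    obtain ⟨j', rfl⟩ := hφ hz
    exact ⟨⟨v, j, j'⟩, rfl⟩

end SmallSet

/-- A continuous increasing chain of small sets of length `κ⁺`, each closed one step later under
the given operations. -/
structure ClosedChain (κ ν : Cardinal.{u}) {W V Q : Type u}
    (op₀ : W → Set Ordinal.{u} → Ordinal.{u})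
    (op : V → Ordinal.{u} → Ordinal.{u} → Ordinal.{u}) (X : Q → Ordinal.{u})
    (N : (succ κ).ord.ToType → Set Ordinal.{u}) : Prop where
  small : ∀ i, SmallSet ν (N i)
  mem : ∀ i q, X q ∈ N i
  mono : Monotone N
  op₀_mem : ∀ i j, i < j → ∀ w, op₀ w (N i) ∈ N j
  op_mem : ∀ i j, i < j → ∀ v, ∀ x ∈ N i, ∀ z ∈ N i, op v x z ∈ N j
  cont : ∀ (φ : ℕ → (succ κ).ord.ToType) i, StrictMono φ → IsLUB (Set.range φ) i →
    ∀ x ∈ N i, ∃ n, x ∈ N (φ n)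

theorem exists_closedChain {κ ν : Cardinal.{u}} (hκ : ℵ₀ ≤ κ) (hκν : κ < ν) {W V Q : Type u}
    (hW : #W ≤ ν) (hV : #V ≤ ν) (hQ : #Q ≤ κ) (op₀ : W → Set Ordinal.{u} → Ordinal.{u})
    (op : V → Ordinal.{u} → Ordinal.{u} → Ordinal.{u}) (X : Q → Ordinal.{u}) :
    ∃ N, ClosedChain κ ν op₀ op X N := by
  have hν : ℵ₀ ≤ ν := hκ.trans hκν.le
  let step : Set Ordinal.{u} → Set Ordinal.{u} := fun M =>
    M ∪ Set.range (fun w => op₀ w M) ∪ {y | ∃ v, ∃ x ∈ M, ∃ z ∈ M, op v x z = y}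
  obtain ⟨N, hN⟩ := exists_recursive (I := (succ κ).ord.ToType) (α := Set Ordinal.{u})
    (fun i F M => M = Set.range X ∪ ⋃ j, step (F j)) (fun i F => ⟨_, rfl⟩)
  have hstep : ∀ i j, i < j → step (N i) ⊆ N j := by
    intro i j hij
    rw [hN j]
    exact (Set.subset_iUnion (fun k : {k // k < j} => step (N k.1)) ⟨i, hij⟩).trans
      Set.subset_union_right
  refine ⟨N, ?_, ?_, ?_, ?_, ?_, ?_⟩
  · intro i
    induction i using WellFoundedLT.induction with
    | _ i IH =>
    rw [hN i]
    refine (SmallSet.range (hQ.trans hκν.le) X).union hν (.iUnion hν ?_ fun j => ?_)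
    · exact (mk_subtype_lt_le i).le.trans (succ_le_of_lt hκν)
    · exact ((IH j.1 j.2).union hν (.range hW _)).union hν ((IH j.1 j.2).image2 hν hV op)
  · intro i q
    rw [hN i]
    exact Or.inl ⟨q, rfl⟩
  · intro i j hij
    rcases hij.eq_or_lt with rfl | h
    · exact le_rfl
    · exact (Set.subset_union_left.trans Set.subset_union_left).trans (hstep i j h)
  · intro i j hij w
    exact hstep i j hij (Or.inl (Or.inr ⟨w, rfl⟩))
  · intro i j hij v x hx z hz
    exact hstep i j hij (Or.inr ⟨v, x, hx, z, hz, rfl⟩)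
  · intro φ i hφ hi x hx
    rw [hN i] at hx
    rcases hx with ⟨q, rfl⟩ | hx
    · refine ⟨0, ?_⟩
      rw [hN]
      exact Or.inl ⟨q, rfl⟩
    · obtain ⟨⟨j, hj⟩, hx⟩ := Set.mem_iUnion.1 hx
      obtain ⟨_, ⟨n, rfl⟩, hn, -⟩ := hi.exists_between hj
      exact ⟨n, hstep _ _ hn hx⟩

/-! ### Suprema of closed chains and their representatives -/

/-- The suprema of `N i` are dominated by `f t` for every `t` past some `o` in the first union. The
hypothesis `h` supplies such a `t` in the second union, which contains the values of `f t`. -/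
theorem eventually_supBelow_le {κ : Cardinal.{u}} (hκ : ℵ₀ ≤ κ) {ι : Type u} (hι : #ι ≤ κ)
    {a : ι → Cardinal.{u}} {μ : Cardinal.{u}} {G : Filter ι} {f : μ.ord.ToType → Sec a}
    {N N' : (succ κ).ord.ToType → Set Ordinal.{u}} (hN : Monotone N)
    (hdom : ∀ i, ∃ o ∈ ⋃ i, N i, o < μ.ord ∧ ∀ t : μ.ord.ToType, o ≤ t.toOrd →
      ∀ᶠ x in G, supBelow (N i) (a x).ord ≤ (f t).1 x)
    (hval : ∀ t : μ.ord.ToType, (t.toOrd : Ordinal) ∈ ⋃ i, N' i → ∀ x, (f t).1 x ∈ ⋃ i, N' i)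
    (h : supBelow (⋃ i, N i) μ.ord ≤ supBelow (⋃ i, N' i) μ.ord) :
    ∀ᶠ x in G, supBelow (⋃ i, N i) (a x).ord ≤ supBelow (⋃ i, N' i) (a x).ord := by
  -- One stage `i` decides the inequality for all later stages at once; otherwise `κ⁺` eventualities
  -- would have to be intersected.
  obtain ⟨i, hi⟩ := exists_subset_iInter hκ hι
    (A := fun i => {x | supBelow (N i) (a x).ord ≤ supBelow (⋃ i, N' i) (a x).ord})
    (fun i j hij x hx => (supBelow_mono (hN hij) _).trans hx)
  obtain ⟨o, ho, hoμ, hot⟩ := hdom i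
  obtain ⟨y, hy, hyμ, hoy⟩ := exists_le_of_lt_supBelow ((lt_supBelow ho hoμ).trans_le h)
  have hy' : ((ToType.mk ⟨y, hyμ⟩ : μ.ord.ToType).toOrd : Ordinal) = y := by simp
  filter_upwards [hot (ToType.mk ⟨y, hyμ⟩) (by rwa [hy'])] with x hx
  have hxi : x ∈ ⋂ j, {x | supBelow (N j) (a x).ord ≤ supBelow (⋃ i, N' i) (a x).ord} :=
    hi (hx.trans (lt_supBelow (hval _ (by rwa [hy']) x) ((f _).2 x)).le)
  refine supBelow_le fun z hz hza => ?_
  obtain ⟨j, hj⟩ := Set.mem_iUnion.1 hz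
  exact (lt_supBelow hj hza).trans_le (Set.mem_iInter.1 hxi j)

theorem mk_small_subsets_le {κ ν : Cardinal.{u}} (hν : ℵ₀ ≤ ν) (hpow : ν ^ κ = ν)
    {K : Type u} (hK : #K ≤ ν) : #{b : Set K // #b ≤ κ} ≤ ν := by
  refine (mk_bounded_set_le K κ).trans ?_
  calc max #K ℵ₀ ^ κ ≤ ν ^ κ := power_le_power_right (max_le hK hν)
    _ = ν := hpow

/-- The suprema of closed chains are, on every small set of coordinates, determined by finitely
many members of a family whose size is bounded by the cofinalities of the ultraproducts. -/
theorem exists_representatives {κ ν θ : Cardinal.{u}} (hκ : ℵ₀ ≤ κ) (hκν : κ < ν)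
    (hpow : ν ^ κ = ν) (hνθ : ν ≤ θ) {K : Type u} (hK : #K ≤ ν) {a : K → Cardinal.{u}}
    (ha : ∀ k, (a k).IsRegular) (hνa : ∀ k, ν < a k)
    (hcof : ∀ b : Set K, #b ≤ κ → ∀ F : Ultrafilter b, ultraproductCof (fun x : b => a x) F ≤ θ)
    (e : Ordinal.{u} → Ordinal.{u} → Ordinal.{u}) {Q : Type u} (hQ : #Q ≤ κ) :
    ∃ (N : (Q → Ordinal.{u}) → (succ κ).ord.ToType → Set Ordinal.{u}) (R : Type u)
      (rep : R → Q → Ordinal.{u}), #R ≤ θ ∧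
      (∀ X, ClosedChain κ ν (fun k M => supBelow M (a k).ord) (fun _ : PUnit.{u + 1} => e)
        X (N X)) ∧
      ∀ X, ∀ b : Set K, #b ≤ κ → ∃ S : Finset R, ∀ k ∈ b, ∃ r ∈ S,
        supBelow (⋃ i, N X i) (a k).ord = supBelow (⋃ i, N (rep r) i) (a k).ord := by
  classical
  have hν : ℵ₀ ≤ ν := hκ.trans hκν.le
  have hθ : ℵ₀ ≤ θ := hν.trans hνθ
  let 𝓑 := {b : Set K // #b ≤ κ}
  have h𝓑 : #𝓑 ≤ ν := mk_small_subsets_le hν hpow hK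
  have hsc := fun b : 𝓑 => exists_scales (a := fun x : b.1 => a x) b.2 (fun x => ha x)
    (fun x => (succ_le_of_lt hκν).trans_lt (hνa x))
  choose μ G f hμ hscale hdesc using hsc
  have hμθ : ∀ b A, A.Nonempty → μ b A ≤ θ := by
    intro b A h
    obtain ⟨F, hF⟩ := hμ b A h
    exact hF ▸ hcof b.1 b.2 F
  let P := Σ b : 𝓑, Set b.1
  have hP : #P ≤ ν := by
    rw [mk_sigma]
    refine (sum_le_sum _ (fun _ => ν) fun b => ?_).trans ?_
    · rw [mk_set]
      calc (2 : Cardinal) ^ #b.1 ≤ 2 ^ κ := power_le_power_left two_ne_zero b.2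
        _ ≤ ν ^ κ := power_le_power_right ((natCast_lt_aleph0 (n := 2)).le.trans hν)
        _ = ν := hpow
    · rw [sum_const']
      exact mul_le_of_le hν h𝓑 le_rfl
  have hdom : ∀ (p : P) (M : Set Ordinal.{u}), ∃ o : Ordinal.{u}, p.2.Nonempty →
      (∀ k, supBelow M (a k).ord < (a k).ord) → o < (μ p.1 p.2).ord ∧
      ∀ t : (μ p.1 p.2).ord.ToType, o ≤ t.toOrd →
        ∀ᶠ x : p.1.1 in G p.1 p.2, supBelow M (a x).ord ≤ (f p.1 p.2 t).1 x := by
    intro p M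
    by_cases h : p.2.Nonempty ∧ ∀ k, supBelow M (a k).ord < (a k).ord
    · obtain ⟨t₀, ht₀⟩ := hscale p.1 p.2 h.1 ⟨fun x => supBelow M (a x).ord, fun x => h.2 x⟩
      exact ⟨t₀.toOrd, fun _ _ => ⟨t₀.toOrd.2, fun t ht => ht₀ t (ToType.mk.symm.le_iff_le.1 ht)⟩⟩
    · exact ⟨0, fun h1 h2 => absurd ⟨h1, h2⟩ h⟩
  choose δ hδ using hdom
  -- The chains are closed under their own suprema, under indices `δ` past which the scale dominates
  -- these suprema, under the collapses `e` and under the values of the scales.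
  let op₀ : K ⊕ P → Set Ordinal.{u} → Ordinal.{u} :=
    Sum.elim (fun k M => supBelow M (a k).ord) δ
  let op : Option (Σ p : P, p.1.1) → Ordinal.{u} → Ordinal.{u} → Ordinal.{u} := fun v =>
    v.elim e fun p η _ =>
      if h : η < (μ p.1.1 p.1.2).ord then (f p.1.1 p.1.2 (ToType.mk ⟨η, h⟩)).1 p.2 else 0
  have hW : #(K ⊕ P) ≤ ν := by simpa using add_le_of_le hν hK hP
  have hV : #(Option (Σ p : P, p.1.1)) ≤ ν := by
    rw [mk_option]
    refine add_le_of_le hν ?_ (one_le_aleph0.trans hν)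
    rw [mk_sigma]
    refine (sum_le_sum _ (fun _ => ν) fun p => p.1.2.trans hκν.le).trans ?_
    rw [sum_const']
    exact mul_le_of_le hν hP le_rfl
  choose N hN using fun X : Q → Ordinal.{u} => exists_closedChain hκ hκν hW hV hQ op₀ op X
  let U : (Q → Ordinal.{u}) → Set Ordinal.{u} := fun X => ⋃ i, N X i
  -- A representative is kept for each possible supremum below `μ`; the successor allows the value
  -- `μ` itself.
  let R := Σ p : {p : P // p.2.Nonempty}, ((μ p.1.1 p.1.2).ord + 1).ToType
  let rep : R → Q → Ordinal.{u} := fun r =>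
    if h : ∃ X, supBelow (U X) (μ r.1.1.1 r.1.1.2).ord = r.2.toOrd then h.choose else fun _ => 0
  have hcompare : ∀ (p : P) X X', p.2.Nonempty →
      supBelow (U X) (μ p.1 p.2).ord ≤ supBelow (U X') (μ p.1 p.2).ord →
      ∀ᶠ x : p.1.1 in G p.1 p.2, supBelow (U X) (a x).ord ≤ supBelow (U X') (a x).ord := by
    intro p X X' hp h
    refine eventually_supBelow_le hκ p.1.2 (a := fun x : p.1.1 => a x) (f := f p.1 p.2)
      (hN X).mono ?_ ?_ h
    · intro i
      obtain ⟨j, hij⟩ := exists_gt_succ_ord hκ i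
      refine ⟨δ p (N X i), Set.mem_iUnion.2 ⟨j, (hN X).op₀_mem i j hij (Sum.inr p)⟩, ?_⟩
      exact hδ p (N X i) hp fun k => supBelow_lt (ha k) (hνa k) ((hN X).small i)
    · intro t ht x
      obtain ⟨i, hi⟩ := Set.mem_iUnion.1 ht
      obtain ⟨j, hij⟩ := exists_gt_succ_ord hκ i
      have := (hN X').op_mem i j hij (some ⟨p, x⟩) _ hi _ hi
      have h2 : (t.toOrd : Ordinal) < (μ p.1 p.2).ord := t.toOrd.2
      have h3 : op (some ⟨p, x⟩) t.toOrd t.toOrd = (f p.1 p.2 t).1 x := by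
        simp only [op, Option.elim]
        rw [dif_pos h2]
        exact congrArg (fun s => (f p.1 p.2 s).1 x) (ToType.mk.apply_symm_apply t)
      exact Set.mem_iUnion.2 ⟨j, h3 ▸ this⟩
  -- One representative is right on a set of the filter of `A`; the remaining coordinates have
  -- smaller `μ`, so well-foundedness leaves finitely many steps.
  have hcover : ∀ X (b : 𝓑) (c : Cardinal.{u}) (A : Set b.1), μ b A = c →
      ∃ S : Finset R, ∀ x ∈ A, ∃ r ∈ S,
        supBelow (U X) (a x).ord = supBelow (U (rep r)) (a x).ord := by
    intro X b c
    induction c using WellFoundedLT.induction with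
    | _ c IH =>
    intro A hA
    rcases A.eq_empty_or_nonempty with rfl | hne
    · exact ⟨∅, fun x hx => absurd hx (Set.notMem_empty x)⟩
    let r : R := ⟨⟨⟨b, A⟩, hne⟩, ToType.mk ⟨supBelow (U X) (μ b A).ord,
      Order.lt_add_one_iff.2 (supBelow_le_self _ _)⟩⟩
    have hr : ∃ X', supBelow (U X') (μ r.1.1.1 r.1.1.2).ord = r.2.toOrd := ⟨X, by simp [r]⟩
    have hrep : supBelow (U (rep r)) (μ b A).ord = supBelow (U X) (μ b A).ord := by
      have := hr.choose_spec
      simp only [rep, dif_pos hr]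
      refine this.trans ?_
      simp [r]
    have hB := (hcompare ⟨b, A⟩ X (rep r) hne hrep.ge).and
      (hcompare ⟨b, A⟩ (rep r) X hne hrep.le)
    let B : Set b.1 := {x | supBelow (U X) (a x).ord = supBelow (U (rep r)) (a x).ord}
    have hB' : B ∈ G b A := by
      filter_upwards [hB] with x hx using le_antisymm hx.1 hx.2
    by_cases hAB : (A \ B).Nonempty
    · obtain ⟨S, hS⟩ := IH _ (hA ▸ hdesc b A hne B hB' hAB) _ rfl
      refine ⟨insert r S, fun x hx => ?_⟩
      by_cases hxB : x ∈ B
      · exact ⟨r, Finset.mem_insert_self _ _, hxB⟩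
      · obtain ⟨s, hs, hs'⟩ := hS x ⟨hx, hxB⟩
        exact ⟨s, Finset.mem_insert_of_mem hs, hs'⟩
    · refine ⟨{r}, fun x hx => ⟨r, Finset.mem_singleton_self r, ?_⟩⟩
      by_contra hxB
      exact hAB ⟨x, hx, hxB⟩
  refine ⟨N, R, rep, ?_, fun X => ⟨(hN X).small, (hN X).mem, (hN X).mono,
    fun i j hij k => (hN X).op₀_mem i j hij (Sum.inl k),
    fun i j hij _ => (hN X).op_mem i j hij none, (hN X).cont⟩, fun X b hb => ?_⟩
  · rw [mk_sigma]
    refine (sum_le_sum _ (fun _ => θ) fun p => ?_).trans ?_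
    · rw [mk_toType, card_add_one, card_ord]
      exact add_le_of_le hθ (hμθ _ _ p.2) (one_le_aleph0.trans hθ)
    · rw [sum_const']
      exact mul_le_of_le hθ ((mk_subtype_le _).trans (hP.trans hνθ)) le_rfl
  · obtain ⟨S, hS⟩ := hcover X ⟨b, hb⟩ _ Set.univ rfl
    exact ⟨S, fun k hk => hS ⟨k, hk⟩ trivial⟩

/-! ### Covering by few small sets -/

theorem exists_collapse : ∃ e : Ordinal.{u} → Ordinal.{u} → Ordinal.{u}, ∀ β,
    Set.InjOn (e β) (Set.Iio β) ∧ ∀ x < β, e β x < β.card.ord := by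
  have h : ∀ β : Ordinal.{u}, ∃ g : Ordinal.{u} → Ordinal.{u},
      Set.InjOn g (Set.Iio β) ∧ ∀ x < β, g x < β.card.ord := by
    intro β
    obtain ⟨φ⟩ : Nonempty (β.ToType ≃ β.card.ord.ToType) := Cardinal.eq.1 (by simp)
    refine ⟨fun x => if h : x < β then ((φ (ToType.mk ⟨x, h⟩)).toOrd : Ordinal) else 0, ?_, ?_⟩
    · intro x hx y hy hxy
      simp only [Set.mem_Iio] at hx hy
      simp only [hx, hy, dif_pos] at hxy
      have := ToType.mk.injective (φ.injective (ToType.mk.symm.injective (Subtype.ext hxy)))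
      exact congrArg Subtype.val this
    · intro x hx
      simp only [hx, dif_pos]
      exact (φ (ToType.mk ⟨x, hx⟩)).toOrd.2
  exact ⟨fun β => (h β).choose, fun β => (h β).choose_spec⟩

/-- Each stage contains the suprema of the earlier ones, so the suprema along either chain increase
continuously and cofinally to the common supremum, and the two sequences interleave. -/
theorem ClosedChain.exists_common_sup {κ ν : Cardinal.{u}} (hκ : ℵ₀ ≤ κ) {K V Q : Type u}
    {a : K → Cardinal.{u}} (ha : ∀ k, (a k).IsRegular) (hνa : ∀ k, ν < a k)
    {op : V → Ordinal.{u} → Ordinal.{u} → Ordinal.{u}} {X X' : Q → Ordinal.{u}}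
    {N N' : (succ κ).ord.ToType → Set Ordinal.{u}}
    (hN : ClosedChain κ ν (fun k M => supBelow M (a k).ord) op X N)
    (hN' : ClosedChain κ ν (fun k M => supBelow M (a k).ord) op X' N') {k k' : K}
    (h : supBelow (⋃ i, N i) (a k).ord = supBelow (⋃ i, N' i) (a k').ord) {x : Ordinal.{u}}
    (hx : x < supBelow (⋃ i, N i) (a k).ord) :
    ∃ i j, supBelow (N i) (a k).ord = supBelow (N' j) (a k').ord ∧
      x < supBelow (N i) (a k).ord := by
  have aux : ∀ {X X' : Q → Ordinal.{u}} {N N' : (succ κ).ord.ToType → Set Ordinal.{u}} {k k' : K},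
      ClosedChain κ ν (fun k M => supBelow M (a k).ord) op X N →
      supBelow (⋃ i, N i) (a k).ord = supBelow (⋃ i, N' i) (a k').ord →
      ∀ i, ∃ j, supBelow (N i) (a k).ord ≤ supBelow (N' j) (a k').ord := by
    intro X X' N N' k k' hN h i
    obtain ⟨i', hi'⟩ := exists_gt_succ_ord hκ i
    have h1 : supBelow (N i) (a k).ord < supBelow (⋃ i, N i) (a k).ord :=
      lt_supBelow (Set.mem_iUnion.2 ⟨i', hN.op₀_mem i i' hi' k⟩)
        (supBelow_lt (ha k) (hνa k) (hN.small i))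
    rw [h] at h1
    obtain ⟨y, hy, hyk, hxy⟩ := exists_le_of_lt_supBelow h1
    obtain ⟨j, hj⟩ := Set.mem_iUnion.1 hy
    exact ⟨j, hxy.trans (lt_supBelow hj hyk).le⟩
  have cont : ∀ {X : Q → Ordinal.{u}} {N : (succ κ).ord.ToType → Set Ordinal.{u}} {k : K},
      ClosedChain κ ν (fun k M => supBelow M (a k).ord) op X N →
      ∀ (φ : ℕ → (succ κ).ord.ToType) i, StrictMono φ → IsLUB (Set.range φ) i →
      ∀ y < supBelow (N i) (a k).ord, ∃ n, y < supBelow (N (φ n)) (a k).ord := by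
    intro X N k hN φ i hφ hi y hy
    obtain ⟨z, hz, hzk, hyz⟩ := exists_le_of_lt_supBelow hy
    obtain ⟨n, hn⟩ := hN.cont φ i hφ hi z hz
    exact ⟨n, hyz.trans_lt (lt_supBelow hn hzk)⟩
  refine exists_common_value hκ (fun i j hij => supBelow_mono (hN.mono hij) _)
    (fun i j hij => supBelow_mono (hN'.mono hij) _) (aux (X' := X') hN h) (aux (X' := X) hN' h.symm)
    (cont hN) (cont hN') ?_
  obtain ⟨y, hy, hyk, hxy⟩ := exists_le_of_lt_supBelow hx
  obtain ⟨i, hi⟩ := Set.mem_iUnion.1 hy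
  exact ⟨i, hxy.trans_lt (lt_supBelow hi hyk)⟩

/-- A covering theorem: the sets of at most `κ` ordinals below `l` are covered by few sets of
size at most `ν`. -/
theorem exists_covering {κ ν θ l : Cardinal.{u}} (hκ : ℵ₀ ≤ κ) (hκν : κ < ν)
    (hpow : ν ^ κ = ν) (hνθ : ν ≤ θ) {K : Type u} (hK : #K ≤ ν) {a : K → Cardinal.{u}}
    (hinj : Function.Injective a) (ha : ∀ k, (a k).IsRegular) (hνa : ∀ k, ν < a k)
    (hsucc : ∀ c, ν ≤ c → c < l → ∃ k, a k = succ c)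
    (hcof : ∀ b : Set K, #b ≤ κ → ∀ F : Ultrafilter b, ultraproductCof (fun x : b => a x) F ≤ θ)
    {Q : Type u} (hQ : #Q ≤ κ) :
    ∃ (R : Type u) (J : Finset R → Type u) (φ : ∀ S, J S → Ordinal.{u}), #R ≤ θ ∧
      (∀ S, #(J S) ≤ ν) ∧
      ∀ X : Q → Ordinal.{u}, (∀ q, X q < l.ord) → ∃ S, ∀ q, X q ∈ Set.range (φ S) := by
  classical
  have hν : ℵ₀ ≤ ν := hκ.trans hκν.le
  obtain ⟨e, he⟩ := exists_collapse.{u}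
  obtain ⟨N, R, rep, hR, hN, hrep⟩ :=
    exists_representatives hκ hκν hpow hνθ hK ha hνa hcof e hQ
  let U : (Q → Ordinal.{u}) → Set Ordinal.{u} := fun X => ⋃ i, N X i
  -- `E γ` is the sequence of suprema of one chosen chain with total supremum `γ`, so it depends on
  -- `γ` alone; any other chain with supremum `γ` meets it cofinally.
  let E : Ordinal.{u} → (succ κ).ord.ToType → Ordinal.{u} := fun γ =>
    if h : ∃ p : (Q → Ordinal.{u}) × K, supBelow (U p.1) (a p.2).ord = γ then
      fun i => supBelow (N h.choose.1 i) (a h.choose.2).ord else fun _ => 0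
  let inv : Ordinal.{u} → Ordinal.{u} → Ordinal.{u} := fun β y =>
    if h : ∃ x, x < β ∧ e β x = y then h.choose else 0
  have hinv : ∀ β x, x < β → inv β (e β x) = x := by
    intro β x hx
    have h : ∃ z, z < β ∧ e β z = e β x := ⟨x, hx, rfl⟩
    simp only [inv, dif_pos h]
    exact (he β).1 h.choose_spec.1 hx h.choose_spec.2
  have hE : ∀ X k x, x < supBelow (U X) (a k).ord → ∃ i j,
      supBelow (N X i) (a k).ord = E (supBelow (U X) (a k).ord) j ∧
        x < supBelow (N X i) (a k).ord := by
    intro X k x hx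
    have h : ∃ p : (Q → Ordinal.{u}) × K,
      supBelow (U p.1) (a p.2).ord = supBelow (U X) (a k).ord := ⟨(X, k), rfl⟩
    simp only [E, dif_pos h]
    exact (hN X).exists_common_sup hκ ha hνa (hN _) h.choose_spec.symm hx
  -- For `a k = succ z.card`, choose `β > z` below `a k` among the stage suprema and the values of
  -- `E`. Then `y = e β z` is below `β.card.ord ≤ z`, and `β` together with `y` gives back `z`.
  have hpath : ∀ X z, z ∈ U X → ν.ord ≤ z → z < l.ord → ∃ y ∈ U X, y < z ∧ ∀ k,
      a k = succ z.card → ∃ j, inv (E (supBelow (U X) (a k).ord) j) y = z := by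
    intro X z hz hνz hzl
    obtain ⟨k, hk⟩ := hsucc z.card (ord_le.1 hνz) (lt_ord.1 hzl)
    have hzk : z < (a k).ord := by
      rw [hk, lt_ord]
      exact lt_succ _
    obtain ⟨i, j, hij, hzi⟩ := hE X k z (lt_supBelow hz hzk)
    have hβk : (supBelow (N X i) (a k).ord).card ≤ z.card := by
      rw [← lt_succ_iff, ← hk, ← lt_ord]
      exact supBelow_lt (ha k) (hνa k) ((hN X).small i)
    obtain ⟨i', hi'⟩ := Set.mem_iUnion.1 hz
    obtain ⟨m, hm⟩ := exists_gt_succ_ord hκ (max i i')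
    obtain ⟨m', hm'⟩ := exists_gt_succ_ord hκ m
    have hβ : supBelow (N X i) (a k).ord ∈ N X m :=
      (hN X).op₀_mem i m ((le_max_left _ _).trans_lt hm) k
    have hzm : z ∈ N X m := (hN X).mono ((le_max_right _ _).trans hm.le) hi'
    refine ⟨e (supBelow (N X i) (a k).ord) z, Set.mem_iUnion.2
      ⟨m', (hN X).op_mem m m' hm' ⟨⟩ _ hβ _ hzm⟩, ?_, fun k' hk' => ⟨j, ?_⟩⟩
    · exact ((he _).2 z hzi).trans_le ((ord_le_ord.2 hβk).trans (ord_card_le z))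
    · rw [← hk] at hk'
      rw [hinj hk', ← hij]
      exact hinv _ _ hzi
  -- A covering set consists of the ordinals decoded from an ordinal below `ν` by a finite list of
  -- instructions, with suprema taken from the representatives in `S`.
  let ev : ∀ S : Finset R,
      List ({r // r ∈ S} × K × (succ κ).ord.ToType) × ν.ord.ToType → Ordinal.{u} := fun S p =>
    p.1.foldr (fun w y => inv (E (supBelow (U (rep w.1.1)) (a w.2.1).ord) w.2.2) y) p.2.toOrd
  refine ⟨R, fun S => List ({r // r ∈ S} × K × (succ κ).ord.ToType) × ν.ord.ToType, ev, hR,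
    fun S => ?_, fun X hX => ?_⟩
  · have hS : #{r // r ∈ S} ≤ ν := (lt_aleph0_of_finite _).le.trans hν
    have hI : #(succ κ).ord.ToType ≤ ν := by
      rw [mk_ord_toType]
      exact succ_le_of_lt hκν
    have h1 : #({r // r ∈ S} × K × (succ κ).ord.ToType) ≤ ν := by
      simp only [mk_prod, Cardinal.lift_id]
      exact mul_le_of_le hν hS (mul_le_of_le hν hK hI)
    rw [mk_prod, Cardinal.lift_id, Cardinal.lift_id]
    exact mul_le_of_le hν ((mk_list_le_max _).trans (max_le hν h1)) (mk_ord_toType ν).le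
  choose! st hst1 hst2 hst3 using hpath X
  -- The descents from all `X q`, stopped on falling below `ν`. They involve at most `κ` cardinals,
  -- so `hrep` applies to all of them with a single finite `S`.
  let D : Set Ordinal.{u} := {z | ∃ q n, (∀ m < n, ν.ord ≤ st^[m] (X q)) ∧ st^[n] (X q) = z}
  have hD : ∀ z ∈ D, z ∈ U X ∧ z < l.ord := by
    rintro _ ⟨q, n, hn, rfl⟩
    induction n with
    | zero => exact ⟨Set.mem_iUnion.2 ⟨ToType.mk ⟨0, (isRegular_succ hκ).ord_pos⟩,
        (hN X).mem _ q⟩, hX q⟩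
    | succ n IH =>
      obtain ⟨h1, h2⟩ := IH fun m hm => hn m (hm.trans n.lt_succ_self)
      rw [Function.iterate_succ_apply']
      have h3 := hn n n.lt_succ_self
      exact ⟨hst1 _ h1 h3 h2, (hst2 _ h1 h3 h2).trans h2⟩
  have hDst : ∀ z ∈ D, ν.ord ≤ z → st z ∈ D := by
    rintro _ ⟨q, n, hn, rfl⟩ hz
    refine ⟨q, n + 1, fun m hm => ?_, Function.iterate_succ_apply' _ _ _⟩
    rcases (Nat.lt_succ_iff.1 hm).eq_or_lt with rfl | h
    · exact hz
    · exact hn m h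
  let b : Set K := {k | ∃ z ∈ D, a k = succ z.card}
  have hb : #b ≤ κ := by
    have h : ∀ k : b, ∃ p : Q × ULift.{u} ℕ, a k = succ (st^[p.2.down] (X p.1)).card := by
      rintro ⟨k, _, ⟨q, n, -, rfl⟩, hk⟩
      exact ⟨(q, ⟨n⟩), hk⟩
    choose p hp using h
    have hpinj : Function.Injective p := by
      intro k k' hkk
      refine Subtype.ext (hinj ?_)
      rw [hp k, hp k', hkk]
    refine (mk_le_of_injective hpinj).trans ?_
    simpa using mul_le_of_le hκ hQ hκ
  obtain ⟨S, hS⟩ := hrep X b hb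
  have hfin : ∀ z ∈ D, z ∈ Set.range (ev S) := by
    intro z
    induction z using WellFoundedLT.induction with
    | _ z IH =>
    intro hz
    by_cases hνz : ν.ord ≤ z
    · obtain ⟨hzU, hzl⟩ := hD z hz
      obtain ⟨k, hk⟩ := hsucc z.card (ord_le.1 hνz) (lt_ord.1 hzl)
      obtain ⟨j, hj⟩ := hst3 z hzU hνz hzl k hk
      obtain ⟨r, hr, hrk⟩ := hS k ⟨z, hz, hk⟩
      obtain ⟨⟨L, ζ⟩, hL⟩ := IH _ (hst2 z hzU hνz hzl) (hDst z hz hνz)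
      refine ⟨⟨(⟨r, hr⟩, k, j) :: L, ζ⟩, ?_⟩
      change inv (E (supBelow (U (rep r)) (a k).ord) j) (ev S ⟨L, ζ⟩) = z
      rw [hL, ← hj]
      change inv (E (supBelow (⋃ i, N (rep r) i) (a k).ord) j) _ = _
      rw [← hrk, hj]
      exact hj
    · exact ⟨⟨[], ToType.mk ⟨z, not_le.1 hνz⟩⟩, by simp [ev]⟩
  exact ⟨S, fun q => hfin _ ⟨q, 0, fun m hm => absurd hm m.not_lt_zero, rfl⟩⟩

/-- A function from `κ` to `l` is determined by a covering set `S` and a function into `J S`: `θ`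
choices times `ν ^ κ = ν`. -/
theorem power_le_of_covering {κ ν θ l : Cardinal.{u}} (hθ : ℵ₀ ≤ θ) (hpow : ν ^ κ = ν)
    (hνθ : ν ≤ θ) {R : Type u} {J : Finset R → Type u} {φ : ∀ S, J S → Ordinal.{u}} (hR : #R ≤ θ)
    (hJ : ∀ S, #(J S) ≤ ν) (h : ∀ X : κ.out → Ordinal.{u}, (∀ q, X q < l.ord) →
      ∃ S, ∀ q, X q ∈ Set.range (φ S)) : l ^ κ ≤ θ := by
  have h' : ∀ X : κ.out → l.ord.ToType, ∃ p : Σ S, κ.out → J S,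
      ∀ q, φ p.1 (p.2 q) = (X q).toOrd := by
    intro X
    obtain ⟨S, hS⟩ := h (fun q => (X q).toOrd) fun q => (X q).toOrd.2
    choose p hp using hS
    exact ⟨⟨S, p⟩, hp⟩
  choose p hp using h'
  have hinj : Function.Injective p := by
    intro X X' hXX
    funext q
    refine ToType.mk.symm.injective (Subtype.ext ?_)
    change ((X q).toOrd : Ordinal) = (X' q).toOrd
    rw [← hp X q, ← hp X' q, hXX]
  have hle := mk_le_of_injective hinj
  have hfin : #(Finset R) ≤ θ := by
    rcases finite_or_infinite R with hR' | hR'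
    · exact (lt_aleph0_of_finite _).le.trans hθ
    · rwa [mk_finset_of_infinite]
  calc l ^ κ = #(κ.out → l.ord.ToType) := by simp
    _ ≤ #(Σ S, κ.out → J S) := hle
    _ ≤ θ := by
      rw [mk_sigma]
      refine (sum_le_sum _ (fun _ => ν) fun S => ?_).trans ?_
      · rw [← power_def, mk_out]
        exact (power_le_power_right (hJ S)).trans_eq hpow
      · rw [sum_const']
        exact mul_le_of_le hθ hfin hνθ

/-! ### The two bounds on the pseudopower -/

theorem le_pow_of_mem_PP {κ l c : Cardinal.{u}} (hc : c ∈ PP κ l) : c ≤ l ^ κ := by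
  obtain ⟨ι, a, F, -, hι, ha, -, rfl⟩ := hc
  obtain ⟨i, -⟩ := F.nonempty_of_mem univ_mem
  refine (ultraproductCof_le_pow (fun i => (ha i).1) univ_mem fun i _ => (ha i).2.le).trans ?_
  exact power_le_power_left ((ha i).1.pos.trans (ha i).2).ne' hι

theorem bddAbove_PP (κ l : Cardinal.{u}) : BddAbove (PP κ l) :=
  ⟨l ^ κ, fun _ => le_pow_of_mem_PP⟩

theorem pp_le_pow (κ l : Cardinal.{u}) : pp κ l ≤ l ^ κ :=
  csSup_le' fun _ => le_pow_of_mem_PP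

/-- Fewer than `l` sections, say `c` many, have a strict pointwise bound at each coordinate with `c
< a i`, and these coordinates form a set in `F`. -/
theorem le_ultraproductCof_of_unbounded {ι : Type u} {a : ι → Cardinal.{u}}
    (ha : ∀ i, (a i).IsRegular) {F : Ultrafilter ι} {l : Cardinal.{u}}
    (hF : ∀ μ < l, {i | μ < a i} ∈ F) : l ≤ ultraproductCof a F := by
  classical
  by_contra! h
  obtain ⟨c, hc⟩ : ∃ c, ultraproductCof a F = c := ⟨_, rfl⟩
  obtain ⟨f, hf⟩ := exists_cofinal_sections hc
  rw [hc] at h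
  let g : Sec a := ⟨fun i => if c < a i then ⨆ j, (f j).1 i + 1 else 0, fun i => by
    dsimp only
    split_ifs with hi
    · refine Ordinal.iSup_lt_of_lt_cof ?_ fun j => ?_
      · rwa [(ha i).cof_ord, mk_ord_toType]
      · exact (isSuccLimit_ord (ha i).aleph0_le).succ_lt ((f j).2 i)
    · exact (ha i).ord_pos⟩
  obtain ⟨j, hj⟩ := hf g
  obtain ⟨i, h1, h2⟩ := (hj.and (hF c h)).exists
  have h2' : c < a i := h2
  simp only [g, if_pos h2'] at h1
  have h3 := Ordinal.le_iSup (fun j => (f j).1 i + 1) j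
  exact absurd ((lt_add_one _).trans_le (h3.trans h1)) (lt_irrefl _)

/-- Enumeration of the successor cardinals in the interval between `ν` and `l`. -/
theorem exists_successors {ν l : Cardinal.{u}} (hν : ℵ₀ ≤ ν) {δ : Ordinal.{u}} (hl : l = ℵ_ δ)
    (hδ : δ.card ≤ ν) (hlim : ∀ c < l, succ c < l) :
    ∃ (K : Type u) (a : K → Cardinal.{u}), #K ≤ ν ∧ Function.Injective a ∧
      (∀ k, (a k).IsRegular) ∧ (∀ k, ν < a k) ∧ (∀ k, a k < l) ∧
      ∀ c, ν ≤ c → c < l → ∃ k, a k = succ c := by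
  refine ⟨{t : δ.ToType // ν ≤ ℵ_ (t.toOrd : Ordinal)}, fun t => succ (ℵ_ (t.1.toOrd : Ordinal)),
    ?_, ?_, ?_, ?_, ?_, ?_⟩
  · refine (mk_subtype_le _).trans ?_
    simpa using hδ
  · intro t t' h
    have := aleph.injective (succ_injective h)
    exact Subtype.ext (ToType.mk.symm.injective (Subtype.ext this))
  · exact fun t => isRegular_succ (hν.trans t.2)
  · exact fun t => t.2.trans_lt (lt_succ _)
  · intro t
    refine hlim _ ?_
    rw [hl]
    exact aleph_lt_aleph.2 t.1.toOrd.2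
  · intro c hνc hcl
    obtain ⟨o, rfl⟩ := mem_range_aleph_iff.2 (hν.trans hνc)
    have ho : o < δ := by
      rw [hl] at hcl
      exact aleph_lt_aleph.1 hcl
    exact ⟨⟨ToType.mk ⟨o, ho⟩, by simpa using hνc⟩, by simp⟩

theorem exists_cofinal_subset {κ l : Cardinal.{u}} (hcof : l.ord.cof ≤ κ)
    {ν : Cardinal.{u}} (hνl : ν < l) {K : Type u}
    {a : K → Cardinal.{u}} (hsucc : ∀ c, ν ≤ c → c < l → ∃ k, a k = succ c) :
    ∃ b : Set K, #b ≤ κ ∧ ∀ μ < l, ∃ k ∈ b, μ < a k := by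
  obtain ⟨s, hs, hsc⟩ := Order.exists_cof_eq l.ord.ToType
  have h : ∀ t : s, ∃ k, a k = succ (max ν (t.1.toOrd : Ordinal).card) := fun t =>
    hsucc _ (le_max_left _ _) (max_lt hνl (lt_ord.1 t.1.toOrd.2))
  choose k hk using h
  refine ⟨Set.range k, mk_range_le.trans ?_, fun μ hμ => ?_⟩
  · rw [hsc, cof_toType]
    exact hcof
  · obtain ⟨t, ht, hμt⟩ := hs (ToType.mk ⟨μ.ord, ord_lt_ord.2 hμ⟩)
    refine ⟨_, ⟨⟨t, ht⟩, rfl⟩, ?_⟩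
    rw [hk, lt_succ_iff]
    refine le_max_of_le_right (ord_le.1 ?_)
    rw [← OrderIso.le_symm_apply] at hμt
    exact hμt

theorem le_pp {κ l : Cardinal.{u}} (hl : ℵ₀ ≤ l) {K : Type u} {a : K → Cardinal.{u}}
    (hinj : Function.Injective a) (ha : ∀ k, (a k).IsRegular) (hal : ∀ k, a k < l) {b : Set K}
    (hb : #b ≤ κ) (hunb : ∀ μ < l, ∃ k ∈ b, μ < a k) : l ≤ pp κ l := by
  let Γ : Set.Iio l → Filter b := fun μ => 𝓟 {x | μ.1 < a x}
  have : Nonempty (Set.Iio l) := ⟨⟨0, aleph0_pos.trans_le hl⟩⟩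
  have hne : (⨅ μ, Γ μ).NeBot := by
    refine iInf_neBot_of_directed' ?_ fun μ => ?_
    · intro μ μ'
      refine ⟨max μ μ', ?_, ?_⟩
      · exact principal_mono.2 fun x hx =>
          (show μ.1 ≤ (max μ μ').1 from le_max_left μ μ').trans_lt hx
      · exact principal_mono.2 fun x hx =>
          (show μ'.1 ≤ (max μ μ').1 from le_max_right μ μ').trans_lt hx
    · obtain ⟨k, hk, hμ⟩ := hunb μ.1 μ.2
      exact principal_neBot_iff.2 ⟨⟨k, hk⟩, hμ⟩
  let F := Ultrafilter.of (⨅ μ, Γ μ)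
  have hF : ∀ μ < l, {x : b | μ < a x} ∈ F := fun μ hμ =>
    le_principal_iff.1 ((Ultrafilter.of_le _).trans (iInf_le Γ ⟨μ, hμ⟩))
  refine (le_ultraproductCof_of_unbounded (fun x : b => ha x) hF).trans
    (le_csSup (bddAbove_PP κ l) ?_)
  refine ⟨b, fun x => a x, F, fun x y h => Subtype.ext (hinj h), hb,
    fun x => ⟨ha x, hal x⟩, ?_, rfl⟩
  rintro s hs ⟨μ, hμ, hsμ⟩
  obtain ⟨x, hx, hx'⟩ := F.nonempty_of_mem (inter_mem hs (hF μ hμ))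
  exact absurd (hsμ x hx) (not_le.2 hx')

theorem ultraproductCof_le_pp {κ l : Cardinal.{u}} (hinacc : IsInaccessibleFor κ l)
    (hl : l ≤ pp κ l) {K : Type u} {a : K → Cardinal.{u}}
    (hinj : Function.Injective a) (ha : ∀ k, (a k).IsRegular) (hal : ∀ k, a k < l) {b : Set K}
    (hb : #b ≤ κ) (F : Ultrafilter b) : ultraproductCof (fun x : b => a x) F ≤ pp κ l := by
  by_cases h : ∀ s ∈ F, ¬ ∃ μ < l, ∀ i ∈ s, a i ≤ μ
  · exact le_csSup (bddAbove_PP κ l) ⟨b, fun x => a x, F, fun x y h => Subtype.ext (hinj h), hb,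
      fun x => ⟨ha x, hal x⟩, h, rfl⟩
  -- Here `F` concentrates below some `μ < l`, and inaccessibility bounds the cofinality by `μ ^ κ <
  -- l`.
  · push Not at h
    obtain ⟨s, hs, μ, hμ, hsμ⟩ := h
    obtain ⟨x, hx⟩ := F.nonempty_of_mem hs
    refine (ultraproductCof_le_pow (fun x : b => ha x) hs hsμ).trans ?_
    have hμ0 : μ ≠ 0 := ((ha x).pos.trans_le (hsμ x hx)).ne'
    exact (power_le_power_left hμ0 hb).trans ((hinacc μ hμ).le.trans hl)

theorem pow_le_pp {κ l : Cardinal.{u}} (hl : ℵ₀ ≤ l) (hcof : l.ord.cof ≤ κ) (hκl : κ < l)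
    (hfix : l < ℵ_ l.ord) (hinacc : IsInaccessibleFor κ l) : l ^ κ ≤ pp κ l := by
  have hκ : ℵ₀ ≤ κ := (aleph0_le_cof_iff.2 (one_lt_cof_iff.2 (isSuccLimit_ord hl))).trans hcof
  have hlim : ∀ c < l, succ c < l := by
    intro c hc
    -- An infinite successor is regular, contrary to `l.ord.cof ≤ κ < l`.
    refine lt_of_le_of_ne (succ_le_of_lt hc) fun h => ?_
    have hc0 : ℵ₀ ≤ c := by
      by_contra! hc0
      exact absurd ((succ_le_of_lt hκl).trans_eq h.symm)
        (succ_lt_succ (hc0.trans_le hκ)).not_ge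
    have := (isRegular_succ hc0).cof_ord
    rw [h] at this
    exact absurd (this ▸ hcof) hκl.not_ge
  obtain ⟨δ, hδ⟩ := mem_range_aleph_iff.2 hl
  have hδl : δ < l.ord := by
    rw [← hδ] at hfix ⊢
    exact aleph_lt_aleph.1 hfix
  -- `succ κ` ensures `κ < ν`, `δ.card` bounds the number of successors by `ν`, and taking the power
  -- `κ` makes `ν ^ κ = ν`. The hypothesis `l < ℵ_ l.ord` serves to give `δ.card < l`.
  have hm : max (succ κ) δ.card < l := max_lt (hlim κ hκl) (lt_ord.1 hδl)
  set m := max (succ κ) δ.card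
  have hmν : m ≤ m ^ κ := self_le_power m (one_le_aleph0.trans hκ)
  have hνl : m ^ κ < l := hinacc m hm
  set ν := m ^ κ with hνdef
  have hκν : κ < ν := (lt_succ κ).trans_le ((le_max_left _ _).trans hmν)
  have hν : ℵ₀ ≤ ν := hκ.trans hκν.le
  have hpow : ν ^ κ = ν := by
    rw [hνdef, ← power_mul, mul_eq_self hκ]
  obtain ⟨K, a, hK, hinj, ha, hνa, hal, hsucc⟩ :=
    exists_successors hν hδ.symm ((le_max_right _ _).trans hmν) hlim
  obtain ⟨b, hb, hunb⟩ := exists_cofinal_subset hcof hνl hsucc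
  have hlpp : l ≤ pp κ l := le_pp hl hinj ha hal hb hunb
  obtain ⟨R, J, φ, hR, hJ, hφ⟩ := exists_covering (θ := pp κ l) (l := l) (Q := κ.out) hκ hκν hpow
    (hνl.le.trans hlpp) hK hinj ha hνa hsucc
    (fun b hb F => ultraproductCof_le_pp hinacc hlpp hinj ha hal hb F) (mk_out κ).le
  exact power_le_of_covering (hl.trans hlpp) hpow (hνl.le.trans hlpp) hR hJ hφ

end ShelahPP

theorem mainTheorem9 :
    (∀ κ l : Cardinal.{u},
      BddAbove (ShelahPP.PP κ l) ∧ ShelahPP.pp κ l ≤ l ^ κ) ∧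
    (∀ κ l : Cardinal.{u}, ℵ₀ ≤ l → l.ord.cof ≤ κ → κ < l → l < Cardinal.aleph l.ord →
      ShelahPP.IsInaccessibleFor κ l → ShelahPP.pp κ l = l ^ κ) :=
  ⟨fun κ l => ⟨ShelahPP.bddAbove_PP κ l, ShelahPP.pp_le_pow κ l⟩,
    fun κ l hl hcof hκl hfix hinacc =>
      (ShelahPP.pp_le_pow κ l).antisymm (ShelahPP.pow_le_pp hl hcof hκl hfix hinacc)⟩
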